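/- Permutations $\pi\in S_n$ are written in one-line notation $\pi_1\cdots\pi_n$. Let $\mathrm{inv}(\pi)$ be the number of pairs $i<j$ with $\pi_i>\pi_j$, let $\mathrm{Av}_n(B)$ be the set of $\pi\in S_n$ that avoid every pattern in $B$, and let $\mathrm{av}_n^k(B)$ be the number of $\pi\in\mathrm{Av}_n(B)$ with $\mathrm{inv}(\pi)=k$. For a value $e$, let $\pi\smallsetminus e$ be the permutation order-isomorphic to the sequence obtained from $\pi$ by removing the entry $e$. Let $\mathrm{id}_m$ be the identity of length $m\ge 0$ and $\pi^{\mathrm{rc}}$ the reverse-complement, $\pi^{\mathrm{rc}}_i=n+1-\pi_{n+1-i}$. A permutation is decomposable if it is a direct sum $\sigma\oplus\tau$ of two nonempty permutations, and indecomposable otherwise; $\pi\in S_n$ is almost decomposable if it is indecomposable but $\pi\smallsetminus e$ is decomposable for some $e\in\{1,\pi_1,n,\pi_n\}$. Every decomposable $1324$-avoiding permutation can be written uniquely as $\pi=\sigma\oplus\mathrm{id}_m\oplus\tau$ with $m\ge 0$ and $\sigma,\tau$ nonempty and indecomposable; put $\widetilde f(\pi)=\sigma\oplus\mathrm{id}_{m+1}\oplus\tau$.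 For a $1324$-avoiding permutation $\pi\in S_n$ that is decomposable or almost decomposable, define $f(\pi)\in S_{n+1}$ as follows. If $\pi$ is decomposable, $f(\pi)=\widetilde f(\pi)$. If $\pi$ is almost decomposable, then: 1. if $\pi\smallsetminus\pi_1$ is decomposable, $f(\pi)$ is the permutation with $f(\pi)_1=\pi_1$ and $f(\pi)\smallsetminus\pi_1=\widetilde f(\pi\smallsetminus\pi_1)$; 2. otherwise, if $\pi\smallsetminus 1$ is decomposable, $f(\pi)=f(\pi^{-1})^{-1}$; 3. otherwise, $f(\pi)=f(\pi^{\mathrm{rc}})^{\mathrm{rc}}$. **Theorem.** If $\pi\in\mathrm{Av}_n(1324,1342)$ is decomposable or almost decomposable and $\mathrm{inv}(\pi)\le 2n-6$, then $f(\pi)$ avoids $1342$. Moreover, for all integers $k\ge 0$ and $n\ge\frac{k+7}{2}$, $$\mathrm{av}_n^k(1324,1342)\le\mathrm{av}_{n+1}^k(1324,1342).$$ -/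

import Mathlib

namespace PermPattern

open Equiv

/-! Permutations of length `n` are elements of `Perm (Fin n)`; positions and values are numbered
from `0`, so the paper-style entry `v` at position `i` becomes `v - 1` at position `i - 1`. -/

/-- `π` contains the pattern `p`: some subsequence of `π` is order-isomorphic to `p`. -/
def Contains {m n : ℕ} (p : Perm (Fin m)) (π : Perm (Fin n)) : Prop :=
  ∃ g : Fin m ↪o Fin n, ∀ i j, π (g i) < π (g j) ↔ p i < p j

/-- `π` avoids the pattern `p`. -/
def Avoids {m n : ℕ} (p : Perm (Fin m)) (π : Perm (Fin n)) : Prop :=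
  ¬ Contains p π

/-- The pattern `1324`. -/
def p1324 : Perm (Fin 4) where
  toFun := ![0, 2, 1, 3]
  invFun := ![0, 2, 1, 3]
  left_inv := by decide
  right_inv := by decide

/-- The pattern `1342`. -/
def p1342 : Perm (Fin 4) where
  toFun := ![0, 2, 3, 1]
  invFun := ![0, 3, 1, 2]
  left_inv := by decide
  right_inv := by decide

/-- The number of inversions: pairs of positions `i < j` with `π i > π j`. -/
def inv {n : ℕ} (π : Perm (Fin n)) : ℕ :=
  (Finset.univ.filter fun ij : Fin n × Fin n => ij.1 < ij.2 ∧ π ij.2 < π ij.1).card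

/-- `Av n B`: the permutations of length `n` that avoid every pattern in `B`. -/
def Av (n : ℕ) (B : Set (Σ m, Perm (Fin m))) : Set (Perm (Fin n)) :=
  {π | ∀ p ∈ B, Avoids p.2 π}

/-- `av n k B`: the number of `B`-avoiding permutations of length `n` with exactly `k`
inversions. -/
noncomputable def av (n k : ℕ) (B : Set (Σ m, Perm (Fin m))) : ℕ :=
  {π : Perm (Fin n) | π ∈ Av n B ∧ inv π = k}.ncard

/-- The set of patterns `{1324, 1342}`. -/
def B1324_1342 : Set (Σ m, Perm (Fin m)) := {⟨4, p1324⟩, ⟨4, p1342⟩}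

/-- Transport of a permutation along an equality of lengths. -/
def castLen {m n : ℕ} (h : m = n) (π : Perm (Fin m)) : Perm (Fin n) :=
  (finCongr h).permCongr π

/-- The direct sum `σ ⊕ τ`. -/
def dsum {m n : ℕ} (σ : Perm (Fin m)) (τ : Perm (Fin n)) : Perm (Fin (m + n)) :=
  finSumFinEquiv.permCongr (Equiv.sumCongr σ τ)

/-- `π` is a direct sum of two nonempty permutations. -/
def Decomposable {n : ℕ} (π : Perm (Fin n)) : Prop :=
  ∃ (a b : ℕ) (σ : Perm (Fin a)) (τ : Perm (Fin b)) (h : a + b = n),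
    0 < a ∧ 0 < b ∧ π = castLen h (dsum σ τ)

/-- `π ∖ e`: delete the entry with value `e` from the one-line notation of `π`, and
standardize. -/
def delete {n : ℕ} (π : Perm (Fin (n + 1))) (e : Fin (n + 1)) : Perm (Fin n) :=
  (finSuccAboveEquiv (π.symm e)).trans
    ((π.subtypeEquiv fun _ => not_congr π.eq_symm_apply).trans (finSuccAboveEquiv e).symm)

theorem succAbove_delete {n : ℕ} (π : Perm (Fin (n + 1))) (e : Fin (n + 1)) (j : Fin n) :
    e.succAbove (delete π e j) = π ((π.symm e).succAbove j) := by
  have h := congrArg Subtype.val ((finSuccAboveEquiv e).apply_symm_apply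
    ((π.subtypeEquiv fun _ => not_congr π.eq_symm_apply) (finSuccAboveEquiv (π.symm e) j)))
  simp only [finSuccAboveEquiv_apply] at h
  exact h

/-- The permutation `ρ` with `ρ i = v` and `ρ ∖ v = σ`. -/
def insertEntry {n : ℕ} (σ : Perm (Fin n)) (i v : Fin (n + 1)) : Perm (Fin (n + 1)) :=
  (finSuccEquiv' i).trans ((optionCongr σ).trans (finSuccEquiv' v).symm)

theorem insertEntry_self {n : ℕ} (σ : Perm (Fin n)) (i v : Fin (n + 1)) :
    insertEntry σ i v i = v := by
  simp [insertEntry]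

theorem insertEntry_succAbove {n : ℕ} (σ : Perm (Fin n)) (i v : Fin (n + 1)) (j : Fin n) :
    insertEntry σ i v (i.succAbove j) = v.succAbove (σ j) := by
  simp [insertEntry]

theorem delete_insertEntry {n : ℕ} (σ : Perm (Fin n)) (i v : Fin (n + 1)) :
    delete (insertEntry σ i v) v = σ := by
  have h : (insertEntry σ i v).symm v = i := by
    rw [Equiv.symm_apply_eq, insertEntry_self]
  ext1 j
  apply Fin.succAbove_right_injective (p := v)
  rw [succAbove_delete, h, insertEntry_succAbove]

/-- `π` is almost decomposable: it is indecomposable, but deleting one of the entries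
`1, π₁, n, πₙ` yields a decomposable permutation. -/
def AlmostDecomposable : {n : ℕ} → Perm (Fin n) → Prop
  | 0, _ => False
  | n + 1, π => ¬ Decomposable π ∧
      ∃ e ∈ ({0, π 0, Fin.last n, π (Fin.last n)} : Set (Fin (n + 1))),
        Decomposable (delete π e)

/-- The reverse-complement. -/
def revCompl {n : ℕ} (π : Perm (Fin n)) : Perm (Fin n) :=
  Fin.revPerm * π * Fin.revPerm

/-- `π = σ ⊕ id_m ⊕ τ` and `ρ = σ ⊕ id_{m+1} ⊕ τ` for some `m ≥ 0` and some nonempty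
indecomposable `σ`, `τ`. -/
def IsFTilde {n : ℕ} (π : Perm (Fin n)) (ρ : Perm (Fin (n + 1))) : Prop :=
  ∃ (a m b : ℕ) (σ : Perm (Fin a)) (τ : Perm (Fin b))
    (h : a + m + b = n) (h' : a + (m + 1) + b = n + 1),
    0 < a ∧ 0 < b ∧ ¬ Decomposable σ ∧ ¬ Decomposable τ ∧
      π = castLen h (dsum (dsum σ (1 : Perm (Fin m))) τ) ∧
      ρ = castLen h' (dsum (dsum σ (1 : Perm (Fin (m + 1)))) τ)

open Classical in
/-- The map `σ ⊕ id_m ⊕ τ ↦ σ ⊕ id_{m+1} ⊕ τ`, where `σ` and `τ` are nonempty and indecomposable.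
Every decomposable `1324`-avoider has this form, in a unique way; the value is irrelevant for
permutations not of this form. -/
noncomputable def fTilde {n : ℕ} (π : Perm (Fin n)) : Perm (Fin (n + 1)) :=
  if h : ∃ ρ, IsFTilde π ρ then h.choose else 1

/-- The first case: the permutation `ρ` with `ρ₁ = π₁` and `ρ ∖ π₁ = fTilde (π ∖ π₁)`. -/
noncomputable def fFirst {n : ℕ} (π : Perm (Fin (n + 1))) : Perm (Fin (n + 2)) :=
  insertEntry (fTilde (delete π (π 0))) 0 (π 0).castSucc

open Classical in
/-- The first two cases: `fFirst π` if `π ∖ π₁` is decomposable, and otherwise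
(used when `π ∖ 1` is decomposable, that is, when the first case applies to `π⁻¹`)
the inverse of `fFirst π⁻¹`. -/
noncomputable def fFirstTwo {n : ℕ} (π : Perm (Fin (n + 1))) : Perm (Fin (n + 2)) :=
  if Decomposable (delete π (π 0)) then fFirst π else (fFirst π⁻¹)⁻¹

open Classical in
/-- The Linusson--Verkama map `f`, meaningful for `1324`-avoiders that are decomposable or almost
decomposable: `fTilde` on decomposable permutations; the first two cases if `π ∖ π₁` or `π ∖ 1` is
decomposable; and otherwise `f (π^rc)^rc`, where one of the first two cases applies to `π^rc`. -/
noncomputable def f : {n : ℕ} → Perm (Fin n) → Perm (Fin (n + 1))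
  | 0, _ => 1
  | _ + 1, π =>
    if Decomposable π then fTilde π
    else if Decomposable (delete π (π 0)) ∨ Decomposable (delete π 0) then fFirstTwo π
    else revCompl (fFirstTwo (revCompl π))

end PermPattern

/-!
The map `fTilde` inserts a fixed point at a cut of `π`, a position `a` for which the first `a`
entries are the `a` smallest ones. If `π` avoids `1324` and `1342`, then its entries before a cut
avoid `132` and those after it avoid `231`; these two facts exclude every occurrence of `1342` that
the new fixed point, or the first, smallest or largest entry put back afterwards, could take part
in. The remaining case is that a cut at `a` appears when the last entry `v` is deleted, but no cut
appears when the first or the smallest one is. Then `0 < v` and `v + 2 ≤ a`, and as `π` avoids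
`1342`, the `a - v` entries in `[v, a)` precede the `v` entries below `v`, and the entries after the
cut decrease; this forces more inversions than allowed.

For the count, let `F n c` be the inversion generating function of the avoiders of length `n` that
can be preceded by a first entry of value `c`. Removing the first entry gives
`F (n + 1) c = ∑ i ≤ c, q ^ i * F n i + q ^ n * F n c` for `c < n`, and induction on `n` shows
`F n c ≤ ∑ i ≤ c, q ^ i * F n i` coefficientwise; hence `F n c ≤ F (n + 1) c`.
-/

namespace PermPattern

open Equiv

section Patterns

variable {m n : ℕ} {p : Perm (Fin m)} {π : Perm (Fin n)}

theorem contains_iff_exists_strictMono :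
    Contains p π ↔ ∃ g : Fin m → Fin n, StrictMono g ∧ StrictMono (π ∘ g ∘ p.symm) := by
  constructor
  · rintro ⟨g, hg⟩
    exact ⟨g, g.strictMono, fun x y hxy => (hg _ _).2 (by simpa using hxy)⟩
  · rintro ⟨g, hg, hπ⟩
    refine ⟨OrderEmbedding.ofStrictMono g hg, fun i j => ?_⟩
    simpa using hπ.lt_iff_lt (a := p i) (b := p j)

protected theorem Contains.inv (h : Contains p π) : Contains p⁻¹ π⁻¹ := by
  rw [contains_iff_exists_strictMono] at h ⊢
  obtain ⟨g, hg, hπ⟩ := h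
  refine ⟨π ∘ g ∘ p.symm, hπ, fun x y hxy => ?_⟩
  simpa [Perm.inv_def] using hg hxy

protected theorem Contains.revCompl (h : Contains p π) : Contains (revCompl p) (revCompl π) := by
  obtain ⟨g, hg⟩ := h
  have hrev : StrictMono fun i : Fin m => (g i.rev).rev := fun i j hij => by simpa using hij
  refine ⟨OrderEmbedding.ofStrictMono _ hrev, fun i j => ?_⟩
  simpa [revCompl] using hg j.rev i.rev

theorem revCompl_revCompl (π : Perm (Fin n)) : revCompl (revCompl π) = π := by
  ext1 p
  simp [revCompl]

protected theorem Avoids.inv (h : Avoids p π) : Avoids p⁻¹ π⁻¹ :=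
  fun h' => h (by simpa using h'.inv)

protected theorem Avoids.revCompl (h : Avoids p π) : Avoids (revCompl p) (revCompl π) :=
  fun h' => h (by simpa only [revCompl_revCompl] using h'.revCompl)

theorem p1324_inv : p1324⁻¹ = p1324 := rfl

theorem revCompl_p1324 : revCompl p1324 = p1324 := by decide

theorem contains_length_four_iff {p : Perm (Fin 4)} :
    Contains p π ↔ ∃ g : Fin 4 → Fin n, (g 0 < g 1 ∧ g 1 < g 2 ∧ g 2 < g 3) ∧
      π (g (p.symm 0)) < π (g (p.symm 1)) ∧ π (g (p.symm 1)) < π (g (p.symm 2)) ∧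
        π (g (p.symm 2)) < π (g (p.symm 3)) := by
  simp [contains_iff_exists_strictMono, Fin.strictMono_iff_lt_succ, Fin.forall_fin_succ]

theorem avoids_p1324_iff :
    Avoids p1324 π ↔ ∀ i j k l, i < j → j < k → k < l → π i < π k → π k < π j → ¬ π j < π l := by
  rw [Avoids, contains_length_four_iff, not_exists]
  exact ⟨fun h i j k l hij hjk hkl hik hkj hjl =>
      h ![i, j, k, l] ⟨⟨hij, hjk, hkl⟩, hik, hkj, hjl⟩,
    fun h g ⟨⟨h01, h12, h23⟩, hik, hkj, hjl⟩ => h _ _ _ _ h01 h12 h23 hik hkj hjl⟩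

theorem avoids_p1342_iff :
    Avoids p1342 π ↔ ∀ i j k l, i < j → j < k → k < l → π i < π l → π l < π j → ¬ π j < π k := by
  rw [Avoids, contains_length_four_iff, not_exists]
  exact ⟨fun h i j k l hij hjk hkl hil hlj hjk' =>
      h ![i, j, k, l] ⟨⟨hij, hjk, hkl⟩, hil, hlj, hjk'⟩,
    fun h g ⟨⟨h01, h12, h23⟩, hil, hlj, hjk⟩ => h _ _ _ _ h01 h12 h23 hil hlj hjk⟩

theorem mem_Av_iff : π ∈ Av n B1324_1342 ↔ Avoids p1324 π ∧ Avoids p1342 π := by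
  simp [Av, B1324_1342]

end Patterns

section Insertion

variable {n : ℕ}

theorem insertEntry_delete (π : Perm (Fin (n + 1))) (e : Fin (n + 1)) :
    insertEntry (delete π e) (π⁻¹ e) e = π := by
  ext1 p
  rcases Fin.eq_self_or_eq_succAbove (π⁻¹ e) p with rfl | ⟨j, rfl⟩
  · rw [insertEntry_self, Perm.inv_def, apply_symm_apply]
  · rw [insertEntry_succAbove, succAbove_delete, Perm.inv_def]

theorem insertEntry_delete_apply (π : Perm (Fin (n + 1))) (i : Fin (n + 1)) :
    insertEntry (delete π (π i)) i (π i) = π := by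
  simpa using insertEntry_delete π (π i)

theorem insertEntry_inv (σ : Perm (Fin n)) (i v : Fin (n + 1)) :
    (insertEntry σ i v)⁻¹ = insertEntry σ⁻¹ v i := by
  ext1 p
  rw [Perm.inv_eq_iff_eq]
  rcases Fin.eq_self_or_eq_succAbove v p with rfl | ⟨j, rfl⟩
  · rw [insertEntry_self, insertEntry_self]
  · rw [insertEntry_succAbove, insertEntry_succAbove, Perm.inv_def,
      apply_symm_apply]

theorem revCompl_insertEntry (σ : Perm (Fin n)) (i v : Fin (n + 1)) :
    revCompl (insertEntry σ i v) = insertEntry (revCompl σ) i.rev v.rev := by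
  ext1 p
  simp only [revCompl, Perm.mul_apply, Fin.revPerm_apply]
  rcases Fin.eq_self_or_eq_succAbove i.rev p with rfl | ⟨j, rfl⟩
  · rw [insertEntry_self, Fin.rev_rev, insertEntry_self]
  · rw [insertEntry_succAbove, Fin.rev_succAbove, Fin.rev_rev, insertEntry_succAbove,
      Fin.rev_succAbove]
    rfl

theorem insertEntry_lt_insertEntry_iff (σ : Perm (Fin n)) (i v : Fin (n + 1)) (j k : Fin n) :
    insertEntry σ i v (i.succAbove j) < insertEntry σ i v (i.succAbove k) ↔ σ j < σ k := by
  rw [insertEntry_succAbove, insertEntry_succAbove, Fin.succAbove_lt_succAbove_iff]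

theorem insertEntry_zero_succ (σ : Perm (Fin n)) (v : Fin (n + 1)) (j : Fin n) :
    insertEntry σ 0 v j.succ = v.succAbove (σ j) := by
  rw [← Fin.zero_succAbove, insertEntry_succAbove]

theorem insertEntry_last_castSucc (σ : Perm (Fin n)) (v : Fin (n + 1)) (j : Fin n) :
    insertEntry σ (Fin.last n) v j.castSucc = v.succAbove (σ j) := by
  rw [← Fin.succAbove_last_apply, insertEntry_succAbove]

theorem Avoids.of_insertEntry {m : ℕ} {p : Perm (Fin m)} {σ : Perm (Fin n)} {i v : Fin (n + 1)}
    (h : Avoids p (insertEntry σ i v)) : Avoids p σ := by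
  rintro ⟨g, hg⟩
  refine h ⟨g.trans (Fin.succAboveOrderEmb i), fun x y => ?_⟩
  rw [← hg]
  exact insertEntry_lt_insertEntry_iff σ i v (g x) (g y)

theorem val_succAbove (a : Fin (n + 1)) (j : Fin n) :
    (a.succAbove j : ℕ) = if (j : ℕ) < a then (j : ℕ) else j + 1 := by
  rw [Fin.succAbove, apply_ite Fin.val]
  rfl

end Insertion

/-- The first `c` entries of `π` are its `c` smallest ones, so that `π` is the direct sum of a
permutation of length `c` and another one if `c ≤ n`. -/
def IsCut {n : ℕ} (π : Perm (Fin n)) (c : ℕ) : Prop :=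
  ∀ i : Fin n, (i : ℕ) < c ↔ (π i : ℕ) < c

section Cuts

variable {m n c : ℕ} {π : Perm (Fin n)}

theorem isCut_of_forall_lt (h : ∀ i : Fin n, (i : ℕ) < c → (π i : ℕ) < c) : IsCut π c := by
  intro i
  refine ⟨h i, fun hi => ?_⟩
  simpa using (Perm.perm_symm_mapsTo_iff_mapsTo (s := {i : Fin n | (i : ℕ) < c})).2 h hi

protected theorem IsCut.inv (h : IsCut π c) : IsCut π⁻¹ c := fun i => by
  simpa using (h (π⁻¹ i)).symm

protected theorem IsCut.revCompl (h : IsCut π c) (hc : c ≤ n) :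
    IsCut (revCompl π) (n - c) := fun i => by
  have := h i.rev
  simp only [revCompl, Perm.mul_apply, Fin.revPerm_apply, Fin.val_rev] at this ⊢
  omega

theorem dsum_castAdd (σ : Perm (Fin m)) (τ : Perm (Fin n)) (i : Fin m) :
    dsum σ τ (i.castAdd n) = (σ i).castAdd n := by
  simp [dsum, Equiv.permCongr_apply]

theorem dsum_natAdd (σ : Perm (Fin m)) (τ : Perm (Fin n)) (i : Fin n) :
    dsum σ τ (i.natAdd m) = (τ i).natAdd m := by
  simp [dsum, Equiv.permCongr_apply]

theorem isCut_dsum (σ : Perm (Fin m)) (τ : Perm (Fin n)) : IsCut (dsum σ τ) m := by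
  intro i
  induction i using Fin.addCases with
  | left i => simp [dsum_castAdd]
  | right i => simp [dsum_natAdd]

theorem isCut_dsum_iff_of_le {σ : Perm (Fin m)} {τ : Perm (Fin n)} (hc : c ≤ m) :
    IsCut (dsum σ τ) c ↔ IsCut σ c := by
  refine ⟨fun h i => by simpa [dsum_castAdd] using h (i.castAdd n), fun h i => ?_⟩
  induction i using Fin.addCases with
  | left i => simpa [dsum_castAdd] using h i
  | right i =>
    simp only [dsum_natAdd, Fin.val_natAdd]
    omega

theorem isCut_dsum_add_iff {σ : Perm (Fin m)} {τ : Perm (Fin n)} :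
    IsCut (dsum σ τ) (m + c) ↔ IsCut τ c := by
  refine ⟨fun h i => by simpa [dsum_natAdd] using h (i.natAdd m), fun h i => ?_⟩
  induction i using Fin.addCases with
  | left i =>
    simp only [dsum_castAdd, Fin.val_castAdd]
    omega
  | right i => simpa [dsum_natAdd] using h i

theorem IsCut.exists_eq_dsum {π : Perm (Fin (m + n))} (h : IsCut π m) :
    ∃ (σ : Perm (Fin m)) (τ : Perm (Fin n)), π = dsum σ τ := by
  have hmaps : Set.MapsTo (finSumFinEquiv.symm.permCongr π)
      (Set.range Sum.inl) (Set.range Sum.inl) := by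
    rintro _ ⟨i, rfl⟩
    have hi : (π (i.castAdd n) : ℕ) < m := (h _).1 (by simp)
    exact ⟨⟨_, hi⟩, (finSumFinEquiv.eq_symm_apply).2 (Fin.ext rfl)⟩
  obtain ⟨⟨σ, τ⟩, hστ⟩ := Perm.mem_sumCongrHom_range_of_perm_mapsTo_inl hmaps
  refine ⟨σ, τ, ?_⟩
  rw [Perm.sumCongrHom_apply] at hστ
  rw [dsum]
  exact (Equiv.permCongr _).symm_apply_eq.1 hστ.symm

theorem decomposable_iff_exists_isCut : Decomposable π ↔ ∃ c, 0 < c ∧ c < n ∧ IsCut π c := by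
  constructor
  · rintro ⟨a, b, σ, τ, rfl, ha, hb, rfl⟩
    exact ⟨a, ha, by omega, isCut_dsum σ τ⟩
  · rintro ⟨c, h0, hc, h⟩
    obtain ⟨b, rfl⟩ := Nat.exists_eq_add_of_le hc.le
    obtain ⟨σ, τ, hστ⟩ := h.exists_eq_dsum
    exact ⟨c, b, σ, τ, rfl, h0, by omega, hστ⟩

protected theorem Decomposable.inv (h : Decomposable π) : Decomposable π⁻¹ := by
  rw [decomposable_iff_exists_isCut] at h ⊢
  obtain ⟨c, h0, hc, h⟩ := h
  exact ⟨c, h0, hc, h.inv⟩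

protected theorem Decomposable.revCompl (h : Decomposable π) : Decomposable (revCompl π) := by
  rw [decomposable_iff_exists_isCut] at h ⊢
  obtain ⟨c, h0, hc, h⟩ := h
  exact ⟨n - c, by omega, by omega, h.revCompl hc.le⟩

theorem decomposable_revCompl_iff : Decomposable (revCompl π) ↔ Decomposable π :=
  ⟨fun h => by simpa only [revCompl_revCompl] using h.revCompl, Decomposable.revCompl⟩

theorem Decomposable.exists_first_last_cut (h : Decomposable π) :
    ∃ a b, 0 < a ∧ a ≤ b ∧ b < n ∧ IsCut π a ∧ IsCut π b ∧
      ∀ c, 0 < c → c < n → IsCut π c → a ≤ c ∧ c ≤ b := by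
  let s : Set ℕ := {c | 0 < c ∧ c < n ∧ IsCut π c}
  have hs : s.Finite := (Set.finite_lt_nat n).subset fun c hc => hc.2.1
  have hne : s.Nonempty := decomposable_iff_exists_isCut.1 h
  obtain ⟨a, ha, hmin⟩ := Set.exists_min_image s id hs hne
  obtain ⟨b, hb, hmax⟩ := Set.exists_max_image s id hs hne
  exact ⟨a, b, ha.1, hmin b hb, hb.2.1, ha.2.2, hb.2.2,
    fun c h0 hn hc => ⟨hmin c ⟨h0, hn, hc⟩, hmax c ⟨h0, hn, hc⟩⟩⟩

end Cuts

section FTilde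

theorem eq_one_of_strictMono {n : ℕ} {π : Perm (Fin n)} (h : StrictMono π) : π = 1 :=
  Equiv.ext (congrFun ((h.range_inj strictMono_id).1 (by simp)))

theorem Avoids.middle_summand_eq_one {a m b : ℕ} {σ : Perm (Fin a)} {μ : Perm (Fin m)}
    {τ : Perm (Fin b)} (h : Avoids p1324 (dsum (dsum σ μ) τ)) (ha : 0 < a) (hb : 0 < b) :
    μ = 1 := by
  refine eq_one_of_strictMono fun i j hij => ?_
  by_contra hlt
  have hlt : μ j < μ i := (not_lt.1 hlt).lt_of_ne fun h => hij.ne' (μ.injective h)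
  refine avoids_p1324_iff.1 h (Fin.castAdd b (Fin.castAdd m ⟨0, ha⟩))
    (Fin.castAdd b (Fin.natAdd a i)) (Fin.castAdd b (Fin.natAdd a j))
    (Fin.natAdd (a + m) ⟨0, hb⟩) ?_ ?_ ?_ ?_ ?_ ?_ <;>
  simp only [dsum_castAdd, dsum_natAdd, Fin.lt_def, Fin.val_castAdd, Fin.val_natAdd] at * <;>
  omega

theorem exists_isFTilde {n : ℕ} {π : Perm (Fin n)} (hav : Avoids p1324 π) (hd : Decomposable π) :
    ∃ ρ, IsFTilde π ρ := by
  obtain ⟨a, b, ha0, hab, hbn, ha, hb, hcuts⟩ := hd.exists_first_last_cut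
  obtain ⟨c, rfl⟩ := Nat.exists_eq_add_of_le hbn.le
  obtain ⟨m, rfl⟩ := Nat.exists_eq_add_of_le hab
  obtain ⟨β, τ, rfl⟩ := hb.exists_eq_dsum
  obtain ⟨σ, μ, rfl⟩ := ((isCut_dsum_iff_of_le hab).1 ha).exists_eq_dsum
  obtain rfl := hav.middle_summand_eq_one ha0 (by omega)
  refine ⟨_, a, m, c, σ, τ, rfl, by omega, ha0, by omega, ?_, ?_, rfl, rfl⟩
  · rw [decomposable_iff_exists_isCut]
    rintro ⟨d, hd0, hda, hd⟩
    have hcut := (isCut_dsum_iff_of_le (τ := τ) (by omega)).2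
      ((isCut_dsum_iff_of_le (τ := (1 : Perm (Fin m))) hda.le).2 hd)
    exact hda.not_ge (hcuts d hd0 (by omega) hcut).1
  · rw [decomposable_iff_exists_isCut]
    rintro ⟨d, hd0, hdc, hd⟩
    have := (hcuts (a + m + d) (by omega) (by omega) (isCut_dsum_add_iff.2 hd)).2
    omega

theorem val_dsum {m n : ℕ} (σ : Perm (Fin m)) (τ : Perm (Fin n)) (i : Fin (m + n)) :
    (dsum σ τ i : ℕ) =
      if h : (i : ℕ) < m then (σ ⟨i, h⟩ : ℕ) else m + τ ⟨i - m, by omega⟩ := by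
  induction i using Fin.addCases with
  | left i => simp [dsum_castAdd]
  | right i => simp [dsum_natAdd]

theorem castLen_dsum_one_succ {a m b : ℕ} (σ : Perm (Fin a)) (τ : Perm (Fin b))
    (h : a + (m + 1) + b = a + m + b + 1) :
    castLen h (dsum (dsum σ 1) τ) =
      insertEntry (dsum (dsum σ (1 : Perm (Fin m))) τ) ⟨a, by omega⟩ ⟨a, by omega⟩ := by
  ext i
  change (dsum (dsum σ (1 : Perm (Fin (m + 1)))) τ (i.cast h.symm) : ℕ) = _
  rcases Fin.eq_self_or_eq_succAbove ⟨a, by omega⟩ i with rfl | ⟨j, rfl⟩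
  · rw [insertEntry_self]
    simp [val_dsum]
  · rw [insertEntry_succAbove]
    rcases lt_or_ge (j : ℕ) a with hj | hj
    · have hj₁ : (j : ℕ) < a + (m + 1) := by omega
      have hj₂ : (j : ℕ) < a + m := by omega
      simp [val_dsum, val_succAbove, hj, hj₁, hj₂]
    have hja : ¬ (j : ℕ) < a := by omega
    rcases lt_or_ge (j : ℕ) (a + m) with hj' | hj'
    · have hj₁ : (j : ℕ) + 1 < a + (m + 1) := by omega
      have hj₂ : ¬ (j : ℕ) + 1 < a := by omega
      simp only [val_dsum, Fin.val_cast, val_succAbove, hja, hj', hj₁, hj₂, Perm.coe_one, id_eq,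
        add_lt_iff_neg_left, not_lt_zero, ↓reduceIte, ↓reduceDIte]
      omega
    · have hj₁ : ¬ (j : ℕ) + 1 < a + (m + 1) := by omega
      have hj₂ : ¬ (j : ℕ) < a + m := by omega
      have hsub : (j : ℕ) + 1 - (a + (m + 1)) = j - (a + m) := by omega
      simp only [val_dsum, Fin.val_cast, val_succAbove, hja, hj₁, hj₂, hsub, Nat.add_assoc,
        add_lt_iff_neg_left, not_lt_zero, ↓reduceIte, ↓reduceDIte]
      omega

theorem IsFTilde.exists_eq_insertEntry {n : ℕ} {π : Perm (Fin n)} {ρ : Perm (Fin (n + 1))}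
    (h : IsFTilde π ρ) :
    ∃ a : Fin (n + 1), 0 < (a : ℕ) ∧ (a : ℕ) < n ∧ IsCut π a ∧ ρ = insertEntry π a a := by
  obtain ⟨a, m, b, σ, τ, rfl, h', ha, hb, -, -, rfl, rfl⟩ := h
  exact ⟨⟨a, by omega⟩, ha, show a < a + m + b by omega,
    (isCut_dsum_iff_of_le (Nat.le_add_right a m)).2 (isCut_dsum σ 1), castLen_dsum_one_succ σ τ h'⟩

theorem exists_fTilde_eq {n : ℕ} {π : Perm (Fin n)} (hav : Avoids p1324 π) (hd : Decomposable π) :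
    ∃ a : Fin (n + 1), 0 < (a : ℕ) ∧ (a : ℕ) < n ∧ IsCut π a ∧ fTilde π = insertEntry π a a := by
  have h := exists_isFTilde hav hd
  rw [fTilde, dif_pos h]
  exact h.choose_spec.exists_eq_insertEntry

end FTilde

section FixedPoint

/- The hypothesis `hᵣ` excludes the occurrences of `1342` whose `r`-th entry is the new one. -/
theorem avoids_p1342_insertEntry {n : ℕ} {σ : Perm (Fin n)} {i v : Fin (n + 1)}
    (hσ : Avoids p1342 σ)
    (h₁ : ∀ j k l, i ≤ j.castSucc → j < k → k < l → v ≤ (σ l).castSucc → σ l < σ j → ¬ σ j < σ k)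
    (h₂ : ∀ j k l, j.castSucc < i → i ≤ k.castSucc → k < l → σ j < σ l → (σ l).castSucc < v →
      ¬ v ≤ (σ k).castSucc)
    (h₃ : ∀ j k l, j < k → k.castSucc < i → i ≤ l.castSucc → σ j < σ l → σ l < σ k →
      ¬ (σ k).castSucc < v)
    (h₄ : ∀ j k l, j < k → k < l → l.castSucc < i → (σ j).castSucc < v → v ≤ (σ k).castSucc →
      ¬ σ k < σ l) :
    Avoids p1342 (insertEntry σ i v) := by
  rw [avoids_p1342_iff] at hσ ⊢
  intro a b c d hab hbc hcd had hdb hbc'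
  have new_or_old := Fin.eq_self_or_eq_succAbove i
  rcases new_or_old a with rfl | ⟨a, rfl⟩ <;> rcases new_or_old b with rfl | ⟨b, rfl⟩ <;>
  rcases new_or_old c with rfl | ⟨c, rfl⟩ <;> rcases new_or_old d with rfl | ⟨d, rfl⟩ <;>
  simp only [insertEntry_self, insertEntry_succAbove, Fin.succAbove_lt_succAbove_iff,
    Fin.lt_succAbove_iff_le_castSucc, Fin.succAbove_lt_iff_castSucc_lt, lt_irrefl]
    at hab hbc hcd had hdb hbc' <;>
  first
  | exact h₁ _ _ _ hab hbc hcd had hdb hbc'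
  | exact h₂ _ _ _ hab hbc hcd had hdb hbc'
  | exact h₃ _ _ _ hab hbc hcd had hdb hbc'
  | exact h₄ _ _ _ hab hbc hcd had hdb hbc'
  | exact hσ _ _ _ _ hab hbc hcd had hdb hbc'
  | order

theorem IsCut.insertEntry_of_le {n c : ℕ} {σ : Perm (Fin n)} {i v : Fin (n + 1)}
    (h : IsCut σ c) (hi : (i : ℕ) ≤ c) (hv : (v : ℕ) ≤ c) :
    IsCut (insertEntry σ i v) (c + 1) := by
  simp only [IsCut, Fin.forall_iff_succAbove i, insertEntry_self, insertEntry_succAbove,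
    val_succAbove]
  refine ⟨by omega, fun j => ?_⟩
  have := h j
  split_ifs <;> omega

theorem IsCut.insertEntry_of_ge {n c : ℕ} {σ : Perm (Fin n)} {i v : Fin (n + 1)}
    (h : IsCut σ c) (hi : c ≤ (i : ℕ)) (hv : c ≤ (v : ℕ)) :
    IsCut (insertEntry σ i v) c := by
  simp only [IsCut, Fin.forall_iff_succAbove i, insertEntry_self, insertEntry_succAbove,
    val_succAbove]
  refine ⟨by omega, fun j => ?_⟩
  have := h j
  split_ifs <;> omega

theorem no_231_after_cut {n a : ℕ} {σ : Perm (Fin n)} (hσ : Avoids p1342 σ) (ha : 0 < a)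
    (h : IsCut σ a) {j k l : Fin n} (hj : a ≤ j) (hjk : j < k) (hkl : k < l) (hlj : σ l < σ j) :
    ¬ σ j < σ k := by
  have hn : 0 < n := by omega
  have h0 := h ⟨0, hn⟩
  have hl := h l
  refine avoids_p1342_iff.1 hσ ⟨0, hn⟩ j k l ?_ hjk hkl ?_ hlj <;>
  simp only [Fin.lt_def] at * <;> omega

theorem no_132_before_cut {n a : ℕ} {σ : Perm (Fin n)} (hσ : Avoids p1324 σ) (ha : a < n)
    (h : IsCut σ a) {j k l : Fin n} (hl : (l : ℕ) < a) (hjk : j < k) (hkl : k < l)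
    (hjl : σ j < σ l) : ¬ σ l < σ k := by
  intro hlk
  have h0 := h ⟨a, ha⟩
  have hk := h k
  refine avoids_p1324_iff.1 hσ j k l ⟨a, ha⟩ hjk hkl ?_ hjl hlk ?_ <;>
  simp only [Fin.lt_def] at * <;> omega

theorem IsCut.avoids_p1342_insertEntry_self {n : ℕ} {σ : Perm (Fin n)} {a : Fin (n + 1)}
    (h : IsCut σ a) (hσ : Avoids p1342 σ) (ha : 0 < (a : ℕ)) :
    Avoids p1342 (insertEntry σ a a) := by
  apply avoids_p1342_insertEntry hσ
  · intro j k l hj hjk hkl _ hlj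
    exact no_231_after_cut hσ ha h hj hjk hkl hlj
  all_goals
    intro j k l
    have := h k
    have := h l
    simp only [Fin.lt_def, Fin.le_def, Fin.val_castSucc] at *
    omega

theorem avoids_p1342_insertEntry_zero {n a : ℕ} {ρ : Perm (Fin n)} {v : Fin (n + 1)}
    (hρ : Avoids p1342 ρ) (ha : 0 < a) (h : IsCut ρ a) (hv : a ≤ v) :
    Avoids p1342 (insertEntry ρ 0 v) := by
  apply avoids_p1342_insertEntry hρ
  · intro j k l _ hjk hkl hl hlj
    refine no_231_after_cut hρ ha h ?_ hjk hkl hlj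
    have hj := h j
    simp only [Fin.lt_def, Fin.le_def, Fin.val_castSucc] at *
    omega
  all_goals
    intros
    simp only [Fin.lt_def, Fin.le_def, Fin.val_castSucc, Fin.val_zero] at *
    omega

theorem avoids_p1342_insertEntry_min {n a : ℕ} {ρ : Perm (Fin n)} {i : Fin (n + 1)}
    (hρ : Avoids p1342 ρ) (ha : 0 < a) (h : IsCut ρ a) (hi : a ≤ i) :
    Avoids p1342 (insertEntry ρ i 0) := by
  apply avoids_p1342_insertEntry hρ
  · intro j k l hj hjk hkl _ hlj
    exact no_231_after_cut hρ ha h (hi.trans hj) hjk hkl hlj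
  all_goals
    intros
    simp only [Fin.lt_def, Fin.le_def, Fin.val_castSucc, Fin.val_zero] at *
    omega

theorem avoids_p1342_insertEntry_max {n a : ℕ} {ρ : Perm (Fin n)} {i : Fin (n + 1)}
    (hρ : Avoids p1342 ρ)
    (h132 : ∀ j k l : Fin n, (l : ℕ) < a → j < k → k < l → ρ j < ρ l → ¬ ρ l < ρ k)
    (h : IsCut ρ a) (hi : (i : ℕ) ≤ a) :
    Avoids p1342 (insertEntry ρ i (Fin.last n)) := by
  have hlast (x : Fin n) : ¬ Fin.last n ≤ x.castSucc := (Fin.castSucc_lt_last x).not_ge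
  apply avoids_p1342_insertEntry hρ
  · intro j k l _ _ _ hl
    exact absurd hl (hlast _)
  · intro j k l _ _ _ _ _
    exact hlast _
  · intro j k l hjk hk hl hjl hlk
    refine absurd hlk (h132 j k l ?_ hjk ?_ hjl)
    · have hk' := h k
      have hl' := h l
      simp only [Fin.lt_def, Fin.val_castSucc] at *
      omega
    · exact Fin.castSucc_lt_castSucc_iff.1 (hk.trans_le hl)
  · intro j k l _ _ _ _ hk
    exact absurd hk (hlast _)

end FixedPoint

section Inversions

variable {n : ℕ}

theorem inv_eq_sum (π : Perm (Fin n)) :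
    inv π = ∑ i, ∑ j, if i < j ∧ π j < π i then 1 else 0 := by
  rw [inv, Finset.card_filter, ← Finset.univ_product_univ, Finset.sum_product]

theorem inv_insertEntry_zero (σ : Perm (Fin n)) (v : Fin (n + 1)) :
    inv (insertEntry σ 0 v) = v + inv σ := by
  rw [inv_eq_sum, inv_eq_sum, Fin.sum_univ_succ]
  congr 1
  · simp only [Fin.sum_univ_succ, lt_irrefl, false_and, if_false, zero_add, Fin.succ_pos, true_and,
      insertEntry_zero_succ, insertEntry_self, Fin.succAbove_lt_iff_castSucc_lt]
    rw [Equiv.sum_comp σ fun y => if y.castSucc < v then 1 else 0, ← Finset.card_filter]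
    simp only [Fin.lt_def, Fin.val_castSucc]
    rw [Fin.card_filter_val_lt, min_eq_right v.is_le]
  · refine Finset.sum_congr rfl fun i _ => ?_
    rw [Fin.sum_univ_succ]
    simp [insertEntry_zero_succ]

theorem inv_revCompl (π : Perm (Fin n)) : inv (revCompl π) = inv π := by
  rw [inv_eq_sum, inv_eq_sum, Finset.sum_comm, ← Equiv.sum_comp Fin.revPerm]
  refine Finset.sum_congr rfl fun i _ => ?_
  rw [← Equiv.sum_comp Fin.revPerm]
  simp [revCompl]

theorem inv_insertEntry_last (σ : Perm (Fin n)) (v : Fin (n + 1)) :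
    inv (insertEntry σ (Fin.last n) v) = (n - v) + inv σ := by
  rw [← inv_revCompl, revCompl_insertEntry, Fin.rev_last, inv_insertEntry_zero, inv_revCompl,
    Fin.val_rev, Nat.add_sub_add_right]

theorem card_mul_card_add_le_inv {σ : Perm (Fin n)} {A B C D : Finset (Fin n)}
    (hAB : ∀ x ∈ A, ∀ y ∈ B, x < y ∧ σ y < σ x) (hCD : ∀ x ∈ C, ∀ y ∈ D, x < y ∧ σ y < σ x)
    (hAC : Disjoint A C) : A.card * B.card + C.card * D.card ≤ inv σ := by
  have hdisj : Disjoint (A ×ˢ B) (C ×ˢ D) := Finset.disjoint_product.2 (Or.inl hAC)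
  rw [← Finset.card_product, ← Finset.card_product, ← Finset.card_union_of_disjoint hdisj]
  refine Finset.card_le_card fun ⟨x, y⟩ hxy => Finset.mem_filter.2 ⟨Finset.mem_univ _, ?_⟩
  rcases Finset.mem_union.1 hxy with hxy | hxy <;> obtain ⟨hx, hy⟩ := Finset.mem_product.1 hxy
  · exact hAB x hx y hy
  · exact hCD x hx y hy

end Inversions

section LastEntry

variable {n a : ℕ} {σ : Perm (Fin n)} {v : Fin (n + 1)}

theorem IsCut.lt_of_indecomposable_insertEntry {i : Fin (n + 1)} (h : IsCut σ a) (ha : a < n)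
    (hind : ¬ Decomposable (insertEntry σ i v)) (hi : (i : ℕ) ≤ a) : a < v := by
  by_contra! hv
  exact hind (decomposable_iff_exists_isCut.2
    ⟨a + 1, by omega, by omega, h.insertEntry_of_le hi hv⟩)

theorem IsCut.gt_of_indecomposable_insertEntry {i : Fin (n + 1)} (h : IsCut σ a) (ha0 : 0 < a)
    (ha : a < n) (hind : ¬ Decomposable (insertEntry σ i v)) (hi : a ≤ i) : v < a := by
  by_contra! hv
  exact hind (decomposable_iff_exists_isCut.2 ⟨a, ha0, by omega, h.insertEntry_of_ge hi hv⟩)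

theorem isCut_delete_first {c : ℕ} {π : Perm (Fin (n + 1))}
    (h : ∀ j : Fin n, (j : ℕ) < c → (π j.succ : ℕ) < c) : IsCut (delete π (π 0)) c := by
  refine isCut_of_forall_lt fun j hj => ?_
  have hdel := succAbove_delete π (π 0) j
  rw [Equiv.symm_apply_apply, Fin.zero_succAbove] at hdel
  have hval := val_succAbove (π 0) (delete π (π 0) j)
  have hlt := h j hj
  rw [hdel] at hval
  split_ifs at hval <;> omega

theorem Avoids.no_132_of_insertEntry_last
    (hav : Avoids p1342 (insertEntry σ (Fin.last n) v)) {x y z : Fin n} (hx : (σ x : ℕ) < v)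
    (hy : (v : ℕ) ≤ σ y) (hxy : x < y) (hyz : y < z) : ¬ σ y < σ z := by
  intro hyz'
  refine avoids_p1342_iff.1 hav x.castSucc y.castSucc z.castSucc (Fin.last n) hxy hyz
    (Fin.castSucc_lt_last z) ?_ ?_ ?_
  · rw [insertEntry_last_castSucc, insertEntry_self, Fin.succAbove_lt_iff_castSucc_lt]
    exact hx
  · rw [insertEntry_last_castSucc, insertEntry_self, Fin.lt_succAbove_iff_le_castSucc]
    exact hy
  · rwa [insertEntry_last_castSucc, insertEntry_last_castSucc, Fin.succAbove_lt_succAbove_iff]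

theorem IsCut.lt_of_large_of_small (h : IsCut σ a) (ha : a < n)
    (hav : Avoids p1342 (insertEntry σ (Fin.last n) v)) {x y : Fin n} (hxa : (x : ℕ) < a)
    (hx : (v : ℕ) ≤ σ x) (hy : (σ y : ℕ) < v) : x < y := by
  by_contra! hyx
  have hne : y ≠ x := by rintro rfl; omega
  have hcut := h ⟨a, ha⟩
  have hcutx := h x
  refine hav.no_132_of_insertEntry_last hy hx (hyx.lt_of_ne hne) (z := ⟨a, ha⟩) hxa ?_
  simp only [lt_self_iff_false, false_iff, not_lt] at hcut
  exact Fin.lt_def.2 (by omega)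

theorem IsCut.decreasing_after_of_insertEntry_last (h : IsCut σ a) (hv0 : 0 < (v : ℕ))
    (hva : (v : ℕ) < a) (hav : Avoids p1342 (insertEntry σ (Fin.last n) v)) {x y : Fin n}
    (hx : a ≤ x) (hxy : x < y) : σ y < σ x := by
  obtain ⟨b, hb⟩ := σ.surjective ⟨0, by omega⟩
  have hb0 : (σ b : ℕ) = 0 := congrArg Fin.val hb
  have hcutb := h b
  have hcutx := h x
  have hle := hav.no_132_of_insertEntry_last (x := b) (by omega) (by omega)
    (Fin.lt_def.2 (by omega)) hxy
  exact (not_lt.1 hle).lt_of_ne fun heq => hxy.ne' (σ.injective heq)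

theorem IsCut.sub_mul_add_le_inv (h : IsCut σ a) (ha : a < n) (hv0 : 0 < (v : ℕ))
    (hva : (v : ℕ) < a) (hav : Avoids p1342 (insertEntry σ (Fin.last n) v)) :
    (a - v) * v + (n - 1 - a) ≤ inv σ := by
  have hle := card_mul_card_add_le_inv (σ := σ)
    (A := (Finset.Ico ⟨v, by omega⟩ ⟨a, ha⟩).map σ.symm.toEmbedding)
    (B := (Finset.Iio ⟨v, by omega⟩).map σ.symm.toEmbedding) (C := {⟨a, ha⟩})
    (D := Finset.Ioi ⟨a, ha⟩) ?_ ?_ ?_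
  · simpa using hle
  · intro x hx y hy
    simp only [Finset.mem_map_equiv, Equiv.symm_symm, Finset.mem_Ico, Finset.mem_Iio, Fin.le_def,
      Fin.lt_def] at hx hy
    exact ⟨h.lt_of_large_of_small ha hav ((h x).2 hx.2) hx.1 hy, Fin.lt_def.2 (by omega)⟩
  · intro x hx y hy
    obtain rfl := Finset.mem_singleton.1 hx
    have hxy := Finset.mem_Ioi.1 hy
    exact ⟨hxy, h.decreasing_after_of_insertEntry_last hv0 hva hav le_rfl hxy⟩
  · have hcut := h ⟨a, ha⟩
    simp only [Finset.disjoint_singleton_right, Finset.mem_map_equiv, Equiv.symm_symm,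
      Finset.mem_Ico, Fin.le_def, Fin.lt_def]
    simp only [lt_self_iff_false, false_iff] at hcut
    exact fun hmem => hcut hmem.2

theorem IsCut.decomposable_delete_first (h : IsCut σ (v + 1)) (hv : (v : ℕ) + 1 < n)
    (hv0 : 0 < (v : ℕ)) (hav : Avoids p1342 (insertEntry σ (Fin.last n) v)) :
    Decomposable (delete (insertEntry σ (Fin.last n) v) (insertEntry σ (Fin.last n) v 0)) := by
  obtain ⟨x, hx⟩ := σ.surjective ⟨v, by omega⟩
  have hxv : (σ x : ℕ) = v := congrArg Fin.val hx
  have hcutx := h x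
  have hfirst (y : Fin n) (hy : (y : ℕ) < v + 1) (hyx : y ≠ x) : x < y ∧ (σ y : ℕ) < v := by
    have hyv : (σ y : ℕ) ≠ v := fun heq => hyx (σ.injective (Fin.ext (heq.trans hxv.symm)))
    have hcuty := h y
    have hy' : (σ y : ℕ) < v := by omega
    exact ⟨h.lt_of_large_of_small hv hav (by omega) hxv.ge hy', hy'⟩
  have hx0 : (x : ℕ) = 0 := by
    by_contra hne
    have := (hfirst ⟨0, by omega⟩ (by simp) fun heq => hne (congrArg Fin.val heq.symm)).1
    simp only [Fin.lt_def] at this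
    omega
  obtain ⟨n, rfl⟩ : ∃ k, n = k + 1 := ⟨n - 1, by omega⟩
  obtain rfl : x = 0 := Fin.ext hx0
  refine decomposable_iff_exists_isCut.2 ⟨v, hv0, by omega, isCut_delete_first fun j hj => ?_⟩
  have := val_succAbove v (σ ⟨j + 1, by omega⟩)
  have hlt := (hfirst ⟨j + 1, by omega⟩ (by simpa using hj)
    (Fin.ne_of_val_ne (Nat.succ_ne_zero j))).2
  rw [← insertEntry_last_castSucc, if_pos hlt] at this
  exact this.trans_lt hlt

theorem IsCut.lt_inv_insertEntry_last (h : IsCut σ a) (ha : a < n) (hv0 : 0 < (v : ℕ))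
    (hva : (v : ℕ) < a) (hav : Avoids p1342 (insertEntry σ (Fin.last n) v))
    (hind : ¬ Decomposable
      (delete (insertEntry σ (Fin.last n) v) (insertEntry σ (Fin.last n) v 0))) :
    2 * n - 4 < inv (insertEntry σ (Fin.last n) v) := by
  have hva2 : a ≠ v + 1 := by
    rintro rfl
    exact hind (h.decomposable_delete_first ha hv0 hav)
  have hle := h.sub_mul_add_le_inv ha hv0 hva hav
  have hmul : (a - v) + 2 * v - 2 ≤ (a - v) * v := by
    obtain ⟨s, hs⟩ := Nat.exists_eq_add_of_le (show 2 ≤ a - v by omega)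
    obtain ⟨t, ht⟩ := Nat.exists_eq_add_of_le (show 1 ≤ (v : ℕ) by omega)
    rw [hs, ht]
    ring_nf
    omega
  rw [inv_insertEntry_last]
  omega

end LastEntry

section MapF

variable {n : ℕ}

theorem exists_fFirst_insertEntry_eq {σ : Perm (Fin n)} (v : Fin (n + 1))
    (hav : Avoids p1324 σ) (hd : Decomposable σ) :
    ∃ a : Fin (n + 1), 0 < (a : ℕ) ∧ (a : ℕ) < n ∧ IsCut σ a ∧
      fFirst (insertEntry σ 0 v) = insertEntry (insertEntry σ a a) 0 v.castSucc := by
  obtain ⟨a, h0, hn, ha, h⟩ := exists_fTilde_eq hav hd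
  refine ⟨a, h0, hn, ha, ?_⟩
  rw [fFirst, insertEntry_self, delete_insertEntry, h]

theorem exists_inv_fFirst_inv_insertEntry_eq {σ : Perm (Fin n)} (i : Fin (n + 1))
    (hav : Avoids p1324 σ) (hd : Decomposable σ) :
    ∃ a : Fin (n + 1), 0 < (a : ℕ) ∧ (a : ℕ) < n ∧ IsCut σ a ∧
      (fFirst (insertEntry σ i 0)⁻¹)⁻¹ = insertEntry (insertEntry σ a a) i.castSucc 0 := by
  have hav' : Avoids p1324 σ⁻¹ := p1324_inv ▸ hav.inv
  obtain ⟨a, h0, hn, ha, h⟩ := exists_fFirst_insertEntry_eq i hav' hd.inv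
  refine ⟨a, h0, hn, by simpa using ha.inv, ?_⟩
  rw [insertEntry_inv, h, insertEntry_inv, insertEntry_inv, inv_inv]

theorem exists_revCompl_inv_fFirst_inv_insertEntry_eq {σ : Perm (Fin n)} (i : Fin (n + 1))
    (hav : Avoids p1324 σ) (hd : Decomposable σ) :
    ∃ a : Fin (n + 1), 0 < (a : ℕ) ∧ (a : ℕ) < n ∧ IsCut σ a ∧
      revCompl (fFirst (revCompl (insertEntry σ i (Fin.last n)))⁻¹)⁻¹ =
        insertEntry (insertEntry σ a a) i.succ (Fin.last (n + 1)) := by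
  have hav' : Avoids p1324 (revCompl σ) := revCompl_p1324 ▸ hav.revCompl
  obtain ⟨a, h0, hn, ha, h⟩ := exists_inv_fFirst_inv_insertEntry_eq i.rev hav' hd.revCompl
  have hrev : n - (a : ℕ) = a.rev := by rw [Fin.val_rev, Nat.add_sub_add_right]
  have hcut := ha.revCompl hn.le
  rw [revCompl_revCompl, hrev] at hcut
  refine ⟨a.rev, by omega, by omega, hcut, ?_⟩
  rw [revCompl_insertEntry, Fin.rev_last, h, revCompl_insertEntry, revCompl_insertEntry,
    revCompl_revCompl, Fin.rev_zero, Fin.rev_castSucc, Fin.rev_rev]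

theorem avoids_p1342_fTilde {π : Perm (Fin n)} (h1324 : Avoids p1324 π) (h1342 : Avoids p1342 π)
    (hd : Decomposable π) : Avoids p1342 (fTilde π) := by
  obtain ⟨a, h0, -, ha, h⟩ := exists_fTilde_eq h1324 hd
  rw [h]
  exact ha.avoids_p1342_insertEntry_self h1342 h0

theorem avoids_p1342_fFirst_insertEntry {σ : Perm (Fin n)} {v : Fin (n + 1)}
    (h1324 : Avoids p1324 σ) (h1342 : Avoids p1342 σ) (hd : Decomposable σ)
    (hind : ¬ Decomposable (insertEntry σ 0 v)) :
    Avoids p1342 (fFirst (insertEntry σ 0 v)) := by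
  obtain ⟨a, h0, hn, ha, h⟩ := exists_fFirst_insertEntry_eq v h1324 hd
  rw [h]
  exact avoids_p1342_insertEntry_zero (ha.avoids_p1342_insertEntry_self h1342 h0)
    (Nat.succ_pos _) (ha.insertEntry_of_le le_rfl le_rfl)
    (ha.lt_of_indecomposable_insertEntry hn hind (Nat.zero_le _))

theorem avoids_p1342_inv_fFirst_inv_insertEntry {σ : Perm (Fin n)} {i : Fin (n + 1)}
    (h1324 : Avoids p1324 σ) (h1342 : Avoids p1342 σ) (hd : Decomposable σ)
    (hind : ¬ Decomposable (insertEntry σ i 0)) :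
    Avoids p1342 (fFirst (insertEntry σ i 0)⁻¹)⁻¹ := by
  obtain ⟨a, h0, hn, ha, h⟩ := exists_inv_fFirst_inv_insertEntry_eq i h1324 hd
  have hai : (a : ℕ) < i := by
    by_contra! hia
    exact Nat.not_lt_zero a (ha.lt_of_indecomposable_insertEntry hn hind hia)
  rw [h]
  exact avoids_p1342_insertEntry_min (ha.avoids_p1342_insertEntry_self h1342 h0)
    (Nat.succ_pos _) (ha.insertEntry_of_le le_rfl le_rfl) hai

theorem no_132_before_fixed_point {σ : Perm (Fin n)} {a : Fin (n + 1)} (hσ : Avoids p1324 σ)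
    (h : IsCut σ a) (ha : (a : ℕ) < n) {j k l : Fin (n + 1)} (hl : (l : ℕ) < a) (hjk : j < k)
    (hkl : k < l) (hjl : insertEntry σ a a j < insertEntry σ a a l) :
    ¬ insertEntry σ a a l < insertEntry σ a a k := by
  obtain ⟨l, rfl⟩ := Fin.exists_succAbove_eq (Fin.lt_def.2 hl).ne
  obtain ⟨k, rfl⟩ := Fin.exists_succAbove_eq (hkl.trans (Fin.lt_def.2 hl)).ne
  obtain ⟨j, rfl⟩ := Fin.exists_succAbove_eq (hjk.trans (hkl.trans (Fin.lt_def.2 hl))).ne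
  rw [Fin.succAbove_lt_succAbove_iff] at hjk hkl
  rw [insertEntry_lt_insertEntry_iff] at hjl ⊢
  refine no_132_before_cut hσ ha h ?_ hjk hkl hjl
  rw [val_succAbove] at hl
  split_ifs at hl <;> omega

theorem avoids_p1342_revCompl_inv_fFirst_inv_insertEntry {σ : Perm (Fin n)} {i : Fin (n + 1)}
    (h1324 : Avoids p1324 σ) (h1342 : Avoids p1342 σ) (hd : Decomposable σ)
    (hind : ¬ Decomposable (insertEntry σ i (Fin.last n))) :
    Avoids p1342 (revCompl (fFirst (revCompl (insertEntry σ i (Fin.last n)))⁻¹)⁻¹) := by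
  obtain ⟨a, h0, hn, ha, h⟩ := exists_revCompl_inv_fFirst_inv_insertEntry_eq i h1324 hd
  have hia : (i : ℕ) < a := by
    by_contra! hai
    have := ha.gt_of_indecomposable_insertEntry h0 hn hind hai
    exact hn.asymm this
  rw [h]
  exact avoids_p1342_insertEntry_max (ha.avoids_p1342_insertEntry_self h1342 h0)
    (fun _ _ _ => no_132_before_fixed_point h1324 ha hn) (ha.insertEntry_of_ge le_rfl le_rfl) hia

variable {π : Perm (Fin (n + 1))}

theorem f_of_delete_first (hind : ¬ Decomposable π) (hfirst : Decomposable (delete π (π 0))) :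
    f π = fFirst π := by
  rw [f, if_neg hind, if_pos (Or.inl hfirst), fFirstTwo, if_pos hfirst]

theorem f_of_delete_min (hind : ¬ Decomposable π) (hfirst : ¬ Decomposable (delete π (π 0)))
    (hmin : Decomposable (delete π 0)) : f π = (fFirst π⁻¹)⁻¹ := by
  rw [f, if_neg hind, if_pos (Or.inr hmin), fFirstTwo, if_neg hfirst]

theorem delete_revCompl_first (π : Perm (Fin (n + 1))) :
    delete (revCompl π) (revCompl π 0) = revCompl (delete π (π (Fin.last n))) := by
  conv_lhs => rw [← insertEntry_delete_apply π (Fin.last n)]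
  rw [revCompl_insertEntry, Fin.rev_last, insertEntry_self, delete_insertEntry]

theorem f_of_delete_max (hind : ¬ Decomposable π) (hfirst : ¬ Decomposable (delete π (π 0)))
    (hmin : ¬ Decomposable (delete π 0)) (hlast : ¬ Decomposable (delete π (π (Fin.last n)))) :
    f π = revCompl (fFirst (revCompl π)⁻¹)⁻¹ := by
  rw [← decomposable_revCompl_iff, ← delete_revCompl_first] at hlast
  rw [f, if_neg hind, if_neg (not_or.2 ⟨hfirst, hmin⟩), fFirstTwo, if_neg hlast]

theorem not_decomposable_delete_last (hav : Avoids p1342 π) (hinv : inv π + 4 ≤ 2 * n)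
    (hind : ¬ Decomposable π) (hfirst : ¬ Decomposable (delete π (π 0)))
    (hmin : ¬ Decomposable (delete π 0)) : ¬ Decomposable (delete π (π (Fin.last n))) := by
  intro hlast
  obtain ⟨σ, v, rfl⟩ : ∃ σ v, π = insertEntry σ (Fin.last n) v :=
    ⟨_, _, (insertEntry_delete_apply π (Fin.last n)).symm⟩
  rw [insertEntry_self, delete_insertEntry] at hlast
  have hv : v ≠ 0 := by
    rintro rfl
    rw [delete_insertEntry] at hmin
    exact hmin hlast
  obtain ⟨a, h0, hn, ha⟩ := decomposable_iff_exists_isCut.1 hlast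
  have hva := ha.gt_of_indecomposable_insertEntry h0 hn hind hn.le
  have := ha.lt_inv_insertEntry_last hn (Fin.pos_iff_ne_zero.2 hv) hva hav hfirst
  omega

theorem avoids_p1342_f {n : ℕ} {π : Perm (Fin n)} (hπ : π ∈ Av n B1324_1342)
    (hd : Decomposable π ∨ AlmostDecomposable π) (hinv : (inv π : ℤ) ≤ 2 * (n : ℤ) - 6) :
    Avoids p1342 (f π) := by
  obtain ⟨h1324, h1342⟩ := mem_Av_iff.1 hπ
  obtain _ | n := n
  · omega
  by_cases hdec : Decomposable π
  · rw [f, if_pos hdec]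
    exact avoids_p1342_fTilde h1324 h1342 hdec
  by_cases hfirst : Decomposable (delete π (π 0))
  · rw [f_of_delete_first hdec hfirst]
    rw [← insertEntry_delete_apply π 0] at h1324 h1342 hdec ⊢
    exact avoids_p1342_fFirst_insertEntry h1324.of_insertEntry h1342.of_insertEntry hfirst hdec
  by_cases hmin : Decomposable (delete π 0)
  · rw [f_of_delete_min hdec hfirst hmin]
    rw [← insertEntry_delete π 0] at h1324 h1342 hdec ⊢
    exact avoids_p1342_inv_fFirst_inv_insertEntry h1324.of_insertEntry h1342.of_insertEntry hmin
      hdec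
  have hlast := not_decomposable_delete_last h1342 (by omega) hdec hfirst hmin
  have hmax : Decomposable (delete π (Fin.last n)) := by
    obtain ⟨-, e, rfl | rfl | rfl | rfl, hde⟩ := hd.resolve_left hdec
    exacts [absurd hde hmin, absurd hde hfirst, hde, absurd hde hlast]
  rw [f_of_delete_max hdec hfirst hmin hlast]
  rw [← insertEntry_delete π (Fin.last n)] at h1324 h1342 hdec ⊢
  exact avoids_p1342_revCompl_inv_fFirst_inv_insertEntry h1324.of_insertEntry
    h1342.of_insertEntry hmax hdec

end MapF

section Counting

variable {n c : ℕ}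

/-- The entries `≥ c` of `π` avoid `213` and `231`, that is, no entry `≥ c` is followed by both a
smaller and a larger entry `≥ c`. Prepending a first entry of value `c` to `π` creates no `1324` or
`1342` exactly if this holds. -/
def AvoidsAbove (c : ℕ) (π : Perm (Fin n)) : Prop :=
  ∀ i j k, i < j → i < k → c ≤ (π j : ℕ) → π j < π i → ¬ π i < π k

theorem AvoidsAbove.mono {d : ℕ} {π : Perm (Fin n)} (h : AvoidsAbove c π) (hcd : c ≤ d) :
    AvoidsAbove d π :=
  fun i j k hij hik hj => h i j k hij hik (hcd.trans hj)

theorem avoidsAbove_of_ge (hc : n ≤ c) (π : Perm (Fin n)) : AvoidsAbove c π :=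
  fun _ j _ _ _ hj => absurd (hc.trans hj) (π j).isLt.not_ge

/-- The avoiders of `1324` and `1342` that still avoid both patterns after prepending a first entry
of value `c`. -/
def AvoidsAfter (c : ℕ) (π : Perm (Fin n)) : Prop :=
  π ∈ Av n B1324_1342 ∧ AvoidsAbove c π

theorem mem_Av_iff_forall_lt {π : Perm (Fin n)} :
    π ∈ Av n B1324_1342 ↔
      ∀ l i j k, l < i → i < j → i < k → π l < π j → π j < π i → ¬ π i < π k := by
  rw [mem_Av_iff, avoids_p1324_iff, avoids_p1342_iff]
  constructor
  · rintro ⟨h1324, h1342⟩ l i j k hli hij hik hlj hji hik'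
    rcases lt_trichotomy j k with hjk | rfl | hkj
    · exact h1324 l i j k hli hij hjk hlj hji hik'
    · exact lt_asymm hji hik'
    · exact h1342 l i k j hli hik hkj hlj hji hik'
  · intro h
    exact ⟨fun i j k l hij hjk hkl => h i j k l hij hjk (hjk.trans hkl),
      fun i j k l hij hjk hkl => h i j l k hij (hjk.trans hkl) hjk⟩

theorem insertEntry_zero_mem_Av_iff {σ : Perm (Fin n)} {v : Fin (n + 1)} :
    insertEntry σ 0 v ∈ Av (n + 1) B1324_1342 ↔ AvoidsAfter v σ := by
  rw [AvoidsAfter, mem_Av_iff_forall_lt, mem_Av_iff_forall_lt, AvoidsAbove]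
  simp only [Fin.forall_fin_succ (n := n), insertEntry_zero_succ, insertEntry_self,
    Fin.lt_succAbove_iff_le_castSucc, Fin.succAbove_lt_succAbove_iff, Fin.succ_lt_succ_iff,
    Fin.not_lt_zero, Fin.succ_pos, false_imp_iff, true_imp_iff, implies_true, true_and]
  exact and_comm

theorem avoidsAbove_insertEntry_zero_iff {σ : Perm (Fin n)} {v : Fin (n + 1)} :
    AvoidsAbove c (insertEntry σ 0 v) ↔
      (∀ j k, c ≤ (v.succAbove (σ j) : ℕ) → (σ j : ℕ) < v → (σ k : ℕ) < v) ∧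
        ∀ i j k, i < j → i < k → c ≤ (v.succAbove (σ j) : ℕ) → σ j < σ i → ¬ σ i < σ k := by
  simp only [AvoidsAbove, Fin.forall_fin_succ (n := n), insertEntry_zero_succ, insertEntry_self,
    Fin.succAbove_lt_iff_castSucc_lt, Fin.lt_succAbove_iff_le_castSucc, not_le,
    Fin.succAbove_lt_succAbove_iff, Fin.succ_lt_succ_iff, Fin.not_lt_zero, Fin.succ_pos,
    false_imp_iff, true_imp_iff, implies_true, true_and]
  rfl

theorem avoidsAfter_insertEntry_zero_iff_of_le {σ : Perm (Fin n)} {v : Fin (n + 1)} (hv : v ≤ c) :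
    AvoidsAfter c (insertEntry σ 0 v) ↔ AvoidsAfter v σ := by
  rw [AvoidsAfter, insertEntry_zero_mem_Av_iff, and_iff_left_iff_imp,
    avoidsAbove_insertEntry_zero_iff]
  refine fun h => ⟨fun j k hj hjv => ?_, fun i j k hij hik hj => h.2 i j k hij hik ?_⟩ <;>
  rw [val_succAbove] at hj <;> split_ifs at hj <;> omega

theorem avoidsAfter_insertEntry_zero_iff_of_lt {σ : Perm (Fin n)} {v : Fin (n + 1)} (hv : c < v) :
    AvoidsAfter c (insertEntry σ 0 v) ↔ (v : ℕ) = n ∧ AvoidsAfter c σ := by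
  have hle (x : Fin n) : c ≤ (v.succAbove x : ℕ) ↔ c ≤ x := by
    rw [val_succAbove]
    split_ifs <;> omega
  rw [AvoidsAfter, insertEntry_zero_mem_Av_iff, avoidsAbove_insertEntry_zero_iff]
  simp only [hle]
  constructor
  · rintro ⟨⟨hσ, -⟩, hfirst, hrest⟩
    refine ⟨?_, hσ, hrest⟩
    by_contra hvn
    have hlt := hfirst (σ.symm ⟨c, by omega⟩) (σ.symm ⟨v, by omega⟩)
    simp only [Equiv.apply_symm_apply] at hlt
    exact (hlt le_rfl hv).false
  · rintro ⟨hvn, hσ, habove⟩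
    exact ⟨⟨hσ, habove.mono hv.le⟩, fun j k _ _ => by omega, habove⟩

open Classical in
/-- The number of permutations with `k` inversions that satisfy `AvoidsAfter c`. The argument `k` is
an integer so that it may be lowered freely: the count is `0` for `k < 0`. -/
noncomputable def avAfter (n c : ℕ) (k : ℤ) : ℕ :=
  (Finset.univ.filter fun π : Perm (Fin n) => AvoidsAfter c π ∧ (inv π : ℤ) = k).card

/-- A permutation is determined by its first entry and the pattern of the other entries. -/
def insertFirst (n : ℕ) : Fin (n + 1) × Perm (Fin n) ≃ Perm (Fin (n + 1)) where
  toFun p := insertEntry p.2 0 p.1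
  invFun π := (π 0, delete π (π 0))
  left_inv p := by simp [insertEntry_self, delete_insertEntry]
  right_inv π := insertEntry_delete_apply π 0

theorem avAfter_succ (n c : ℕ) (k : ℤ) :
    avAfter (n + 1) c k = ∑ i ∈ Finset.range (n + 1),
      if i ≤ c then avAfter n i (k - i) else if i = n then avAfter n c (k - n) else 0 := by
  classical
  rw [← Fin.sum_univ_eq_sum_range fun i =>
    if i ≤ c then avAfter n i (k - i) else if i = n then avAfter n c (k - n) else 0,
    avAfter, Finset.card_filter, ← Equiv.sum_comp (insertFirst n), ← Finset.univ_product_univ,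
    Finset.sum_product]
  refine Finset.sum_congr rfl fun v _ => ?_
  have hinv (σ : Perm (Fin n)) : (inv (insertEntry σ 0 v) : ℤ) = k ↔ (inv σ : ℤ) = k - v := by
    rw [inv_insertEntry_zero]
    omega
  simp only [insertFirst, Equiv.coe_fn_mk, hinv]
  rw [← Finset.card_filter]
  split_ifs with hv hvn
  · simp only [avoidsAfter_insertEntry_zero_iff_of_le hv, avAfter]
  · simp only [avoidsAfter_insertEntry_zero_iff_of_lt (not_le.1 hv), hvn, true_and, avAfter]
  · simp [avoidsAfter_insertEntry_zero_iff_of_lt (not_le.1 hv), hvn]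

theorem avAfter_succ_of_lt (hc : c < n) (k : ℤ) :
    avAfter (n + 1) c k =
      ∑ i ∈ Finset.range (c + 1), avAfter n i (k - i) + avAfter n c (k - n) := by
  rw [avAfter_succ, Finset.sum_range_succ, if_neg hc.not_ge, if_pos rfl,
    ← Finset.sum_subset (Finset.range_subset_range.2 (Nat.succ_le_of_lt hc))]
  · congr 1
    exact Finset.sum_congr rfl fun i hi => if_pos (Finset.mem_range_succ_iff.1 hi)
  · intro i hi hi'
    rw [Finset.mem_range] at hi hi'
    rw [if_neg (by omega), if_neg hi.ne]

theorem avAfter_succ_of_ge (hc : n ≤ c) (k : ℤ) :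
    avAfter (n + 1) c k = ∑ i ∈ Finset.range (n + 1), avAfter n i (k - i) := by
  rw [avAfter_succ]
  exact Finset.sum_congr rfl fun i hi => if_pos ((Finset.mem_range_succ_iff.1 hi).trans hc)

theorem av_eq_avAfter (hc : n ≤ c) (k : ℕ) : av n k B1324_1342 = avAfter n c k := by
  classical
  rw [av, avAfter, ← Set.ncard_coe_finset]
  congr 1
  ext π
  simp [AvoidsAfter, avoidsAbove_of_ge hc]

theorem avAfter_eq_of_ge (hc : n ≤ c) (k : ℤ) : avAfter n c k = avAfter n n k := by
  rw [avAfter, avAfter]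
  congr! 3
  simp only [AvoidsAfter, avoidsAbove_of_ge hc, avoidsAbove_of_ge le_rfl]

theorem avAfter_le_succ_of_le_sum
    (h : ∀ c k, avAfter n c k ≤ ∑ i ∈ Finset.range (c + 1), avAfter n i (k - i)) (c : ℕ) (k : ℤ) :
    avAfter n c k ≤ avAfter (n + 1) c k := by
  rcases lt_or_ge c n with hc | hc
  · rw [avAfter_succ_of_lt hc]
    exact (h c k).trans (Nat.le_add_right _ _)
  · rw [avAfter_succ_of_ge hc, avAfter_eq_of_ge hc]
    exact h n k

theorem avAfter_le_sum (n c : ℕ) (k : ℤ) :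
    avAfter n c k ≤ ∑ i ∈ Finset.range (c + 1), avAfter n i (k - i) := by
  induction n generalizing c k with
  | zero =>
    rw [avAfter_eq_of_ge (Nat.zero_le c), Finset.sum_range_succ']
    simp
  | succ n ih =>
    have hmono := avAfter_le_succ_of_le_sum ih
    rcases lt_or_ge c n with hc | hc
    · calc avAfter (n + 1) c k
          = ∑ i ∈ Finset.range (c + 1), avAfter n i (k - i) + avAfter n c (k - n) :=
            avAfter_succ_of_lt hc k
        _ ≤ ∑ i ∈ Finset.range (c + 1), avAfter n i (k - i) +
              ∑ i ∈ Finset.range (c + 1), avAfter n i (k - n - i) :=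
            Nat.add_le_add_left (ih c _) _
        _ = ∑ i ∈ Finset.range (c + 1), (avAfter n i (k - i) + avAfter n i (k - i - n)) := by
            simp only [Finset.sum_add_distrib, sub_right_comm]
        _ ≤ ∑ i ∈ Finset.range (c + 1), avAfter (n + 1) i (k - i) := by
            refine Finset.sum_le_sum fun i hi => ?_
            rw [avAfter_succ_of_lt ((Finset.mem_range_succ_iff.1 hi).trans_lt hc)]
            exact Nat.add_le_add_right (ih i _) _
    · calc avAfter (n + 1) c k
          = ∑ i ∈ Finset.range (n + 1), avAfter n i (k - i) := avAfter_succ_of_ge hc k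
        _ ≤ ∑ i ∈ Finset.range (n + 1), avAfter (n + 1) i (k - i) :=
            Finset.sum_le_sum fun i _ => hmono i _
        _ ≤ ∑ i ∈ Finset.range (c + 1), avAfter (n + 1) i (k - i) :=
            Finset.sum_le_sum_of_subset (Finset.range_subset_range.2 (Nat.succ_le_succ hc))

theorem av_le_av_succ (n k : ℕ) : av n k B1324_1342 ≤ av (n + 1) k B1324_1342 := by
  rw [av_eq_avAfter n.le_succ, av_eq_avAfter le_rfl]
  exact avAfter_le_succ_of_le_sum (avAfter_le_sum n) _ _

end Counting

end PermPattern

theorem theorem6p9_general :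
    (∀ (n : ℕ) (π : Equiv.Perm (Fin n)),
      π ∈ PermPattern.Av n PermPattern.B1324_1342 →
      (PermPattern.Decomposable π ∨ PermPattern.AlmostDecomposable π) →
      (PermPattern.inv π : ℤ) ≤ 2 * (n : ℤ) - 6 →
      PermPattern.Avoids PermPattern.p1342 (PermPattern.f π)) ∧
    (∀ n k : ℕ, PermPattern.av n k PermPattern.B1324_1342 ≤
      PermPattern.av (n + 1) k PermPattern.B1324_1342) :=
  ⟨fun _ _ => PermPattern.avoids_p1342_f, PermPattern.av_le_av_succ⟩

theorem theorem6p9 :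
    (∀ (n : ℕ) (π : Equiv.Perm (Fin n)),
      π ∈ PermPattern.Av n PermPattern.B1324_1342 →
      (PermPattern.Decomposable π ∨ PermPattern.AlmostDecomposable π) →
      (PermPattern.inv π : ℤ) ≤ 2 * (n : ℤ) - 6 →
      PermPattern.Avoids PermPattern.p1342 (PermPattern.f π)) ∧
    (∀ n k : ℕ, ((k : ℚ) + 7) / 2 ≤ (n : ℚ) →
      PermPattern.av n k PermPattern.B1324_1342 ≤
        PermPattern.av (n + 1) k PermPattern.B1324_1342) :=
  ⟨theorem6p9_general.1, fun n k _ => theorem6p9_general.2 n k⟩
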